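/- Let $k$ be a field, let $n\ge 2$ and $r\ge 3n+2$ be integers, and put $s=r(3n+2)+3$. Let $\mathfrak{P}_{nr}\subset k[x_1,x_2,x_3,x_4]$ be the defining ideal of the monomial curve associated to the Backelin semigroup $\langle s,\,s+3,\,s+3n+1,\,s+3n+2\rangle$, i.e. the kernel of the $k$-algebra homomorphism $k[x_1,x_2,x_3,x_4]\to k[t]$ with $x_1\mapsto t^{s}$, $x_2\mapsto t^{s+3}$, $x_3\mapsto t^{s+3n+1}$, $x_4\mapsto t^{s+3n+2}$. Then $\mathfrak{P}_{nr}$ is minimally generated by the following $3n+4$ binomials: $$f_1=x_2x_3^3-x_1x_4^3,$$ $$f_{2i}=x_1^{n-i}x_3^{3i-1}-x_2^{n-i+1}x_4^{3i-2}\qquad(1\le i\le n),$$ $$f_{3j}=x_1^{r-n+3+j}x_2^{n-1-j}-x_3^{2+3j}x_4^{r-1-3j}\qquad(0\le j\le n-1),$$ $$f_{4j}=x_1^{r-2n+3+j}x_2^{2n-j}-x_3^{3j+1}x_4^{r+1-3j}\qquad(0\le j\le n-1),$$ $$f_5=x_1^{r-n+2}x_2^{n}x_3-x_4^{r+2},\qquad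 f_6=x_2^{n+1}x_3-x_1^{n}x_4^{2},\qquad f_7=x_2^{2n+1}-x_1^{2n-1}x_3x_4.$$ That is, these $3n+4$ binomials are pairwise distinct and generate $\mathfrak{P}_{nr}$, no proper subset of them generates $\mathfrak{P}_{nr}$, and every generating set of $\mathfrak{P}_{nr}$ has at least $3n+4$ elements. -/

import Mathlib

noncomputable section

/-- The defining ideal `𝔭(n₁, …, n_r)` of the affine monomial curve `t ↦ (t^{n₁}, …, t^{n_r})`:
the kernel of the `k`-algebra homomorphism `k[x₁, …, x_r] → k[t]`, `x_i ↦ t^{n_i}`. -/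
def monomialCurveIdeal (k : Type*) [Field k] {r : ℕ} (a : Fin r → ℕ) :
    Ideal (MvPolynomial (Fin r) k) :=
  RingHom.ker
    (MvPolynomial.aeval (fun i => (Polynomial.X : Polynomial k) ^ a i) :
      MvPolynomial (Fin r) k →ₐ[k] Polynomial k)

/-- The generators `s, s + 3, s + 3n + 1, s + 3n + 2` of the Backelin semigroup,
where `s = r(3n + 2) + 3`. -/
def backelinSeq (n r : ℕ) : Fin 4 → ℕ :=
  let s := r * (3 * n + 2) + 3
  ![s, s + 3, s + 3 * n + 1, s + 3 * n + 2]

namespace Backelin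

variable (k : Type*) [Field k]

/-! The variables of `k[x₁, x₂, x₃, x₄]`. -/

abbrev x₁ : MvPolynomial (Fin 4) k := MvPolynomial.X 0
abbrev x₂ : MvPolynomial (Fin 4) k := MvPolynomial.X 1
abbrev x₃ : MvPolynomial (Fin 4) k := MvPolynomial.X 2
abbrev x₄ : MvPolynomial (Fin 4) k := MvPolynomial.X 3

/-! The binomials. For `2 ≤ n`, `3n + 2 ≤ r`, `1 ≤ i ≤ n` in `f₂` and `0 ≤ j ≤ n - 1` in `f₃`, `f₄`,
none of the subtractions in the exponents is truncated. -/

def f₁ : MvPolynomial (Fin 4) k :=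
  x₂ k * x₃ k ^ 3 - x₁ k * x₄ k ^ 3

def f₂ (n i : ℕ) : MvPolynomial (Fin 4) k :=
  x₁ k ^ (n - i) * x₃ k ^ (3 * i - 1) - x₂ k ^ (n - i + 1) * x₄ k ^ (3 * i - 2)

def f₃ (n r j : ℕ) : MvPolynomial (Fin 4) k :=
  x₁ k ^ (r - n + 3 + j) * x₂ k ^ (n - 1 - j) - x₃ k ^ (2 + 3 * j) * x₄ k ^ (r - 1 - 3 * j)

def f₄ (n r j : ℕ) : MvPolynomial (Fin 4) k :=
  x₁ k ^ (r - 2 * n + 3 + j) * x₂ k ^ (2 * n - j) - x₃ k ^ (3 * j + 1) * x₄ k ^ (r + 1 - 3 * j)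

def f₅ (n r : ℕ) : MvPolynomial (Fin 4) k :=
  x₁ k ^ (r - n + 2) * x₂ k ^ n * x₃ k - x₄ k ^ (r + 2)

def f₆ (n : ℕ) : MvPolynomial (Fin 4) k :=
  x₂ k ^ (n + 1) * x₃ k - x₁ k ^ n * x₄ k ^ 2

def f₇ (n : ℕ) : MvPolynomial (Fin 4) k :=
  x₂ k ^ (2 * n + 1) - x₁ k ^ (2 * n - 1) * x₃ k * x₄ k

/-- The set of all the binomials `f₁`, `f₂ᵢ` (`1 ≤ i ≤ n`), `f₃ⱼ`, `f₄ⱼ` (`0 ≤ j ≤ n - 1`),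
`f₅`, `f₆`, `f₇`. -/
def gens (n r : ℕ) : Set (MvPolynomial (Fin 4) k) :=
  {f₁ k} ∪ {p | ∃ i, 1 ≤ i ∧ i ≤ n ∧ p = f₂ k n i} ∪
    {p | ∃ j, j < n ∧ p = f₃ k n r j} ∪ {p | ∃ j, j < n ∧ p = f₄ k n r j} ∪
    {f₅ k n r, f₆ k n, f₇ k n}

end Backelin

end

/-!
The monomials fall into congruence classes modulo an ideal generated by binomials. Such an ideal is
the full ideal of the curve as soon as every class meets a set of monomials on which the weight is
injective. For the binomials at hand, every monomial is congruent either to a normal monomial or to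
a multiple of `x₁`; in the second case `x₁` is divided out and one argues by induction on the
weight.

For the number of generators, the first monomial of each binomial has no variable in common with
any other monomial of the same weight. Hence its coefficient vanishes on `𝔪 𝔓`, where
`𝔪 = (x₁, x₂, x₃, x₄)`, and the binomials have as dual basis these coefficient functionals on
`𝔓 / 𝔪 𝔓`, whose dimension bounds the number of generators from below.
-/

open MvPolynomial

section MonomialCongruence

variable {σ R : Type*} [CommRing R]

/-- The congruence on exponent vectors induced by an ideal `I`: the vectors `u` and `v` are
congruent if the monomials `x^u` and `x^v` agree modulo `I`, that is, if the binomial `x^u - x^v`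
lies in `I`. -/
def monomialCon (I : Ideal (MvPolynomial σ R)) : AddCon (σ →₀ ℕ) where
  r u v := Ideal.Quotient.mk I (monomial u 1) = Ideal.Quotient.mk I (monomial v 1)
  iseqv := ⟨fun _ => rfl, Eq.symm, Eq.trans⟩
  add' {u v u' v'} h h' := by
    rw [← one_mul (1 : R), ← monomial_mul, ← monomial_mul, map_mul, map_mul, h, h']

theorem monomialCon_iff {I : Ideal (MvPolynomial σ R)} {u v : σ →₀ ℕ} :
    monomialCon I u v ↔ monomial u 1 - monomial v 1 ∈ I :=
  Ideal.Quotient.eq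

theorem monomialCon_mono {I J : Ideal (MvPolynomial σ R)} (hIJ : I ≤ J) {u v : σ →₀ ℕ}
    (h : monomialCon I u v) : monomialCon J u v :=
  monomialCon_iff.2 (hIJ (monomialCon_iff.1 h))

theorem con_add_tsub_of_le {c : AddCon (σ →₀ ℕ)} {u v w : σ →₀ ℕ} (huv : c u v) (huw : u ≤ w) :
    c w (v + (w - u)) := by
  simpa only [add_tsub_cancel_of_le huw] using c.add huv (c.refl (w - u))

/-- Modulo the congruence `c`, the monomial with exponent vector `u` is a multiple of the variable
with index `i`. -/
def IsMultipleMod (c : AddCon (σ →₀ ℕ)) (i : σ) (u : σ →₀ ℕ) : Prop :=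
  ∃ v, c u v ∧ v i ≠ 0

theorem IsMultipleMod.of_con {c : AddCon (σ →₀ ℕ)} {i : σ} {u v : σ →₀ ℕ} (huv : c u v)
    (hv : IsMultipleMod c i v) : IsMultipleMod c i u :=
  let ⟨w, hvw, hw⟩ := hv
  ⟨w, c.trans huv hvw, hw⟩

theorem IsMultipleMod.of_le {c : AddCon (σ →₀ ℕ)} {i : σ} {u w : σ →₀ ℕ}
    (hu : IsMultipleMod c i u) (huw : u ≤ w) : IsMultipleMod c i w := by
  obtain ⟨v, huv, hv⟩ := hu
  exact ⟨v + (w - u), con_add_tsub_of_le huv huw, by simp [hv]⟩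

/-- Removing a factor `x_i` lowers the weight, so repeatedly doing so and renormalizing
terminates. -/
theorem exists_mem_con_of_isMultipleMod {c : AddCon (σ →₀ ℕ)} {w : σ → ℕ} {i : σ} (hi : w i ≠ 0)
    (hc : ∀ u v, c u v → Finsupp.weight w u = Finsupp.weight w v) {N : Set (σ →₀ ℕ)}
    (hN : ∀ u ∈ N, u + Finsupp.single i 1 ∈ N)
    (hred : ∀ u, (∃ v ∈ N, c u v) ∨ IsMultipleMod c i u) (u : σ →₀ ℕ) : ∃ v ∈ N, c u v := by
  induction hd : Finsupp.weight w u using Nat.strong_induction_on generalizing u with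
  | _ d ih =>
  rcases hred u with hnormal | ⟨v, huv, hv⟩
  · exact hnormal
  obtain ⟨v, rfl⟩ := exists_add_of_le (Finsupp.single_le_iff.2 (Nat.one_le_iff_ne_zero.2 hv))
  have hlt : Finsupp.weight w v < d := by
    rw [← hd, hc _ _ huv, map_add, Finsupp.weight_single]
    simp [Nat.pos_of_ne_zero hi]
  obtain ⟨v', hv', hvv'⟩ := ih _ hlt v rfl
  refine ⟨v' + Finsupp.single i 1, hN v' hv', c.trans huv ?_⟩
  rw [add_comm]
  exact c.add hvv' (c.refl _)

end MonomialCongruence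

section MonomialCurve

variable {k : Type*} [Field k] {m : ℕ} {a : Fin m → ℕ}

theorem aeval_X_pow_monomial (u : Fin m →₀ ℕ) (c : k) :
    aeval (fun i => (Polynomial.X : Polynomial k) ^ a i) (monomial u c) =
      Polynomial.monomial (Finsupp.weight a u) c := by
  simp only [aeval_monomial, Polynomial.algebraMap_eq, ← pow_mul, Finsupp.prod,
    Finset.prod_pow_eq_pow_sum, Polynomial.C_mul_X_pow_eq_monomial, Finsupp.weight_apply,
    Finsupp.sum, smul_eq_mul, mul_comm]

theorem coeff_aeval_X_pow (p : MvPolynomial (Fin m) k) (d : ℕ) :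
    (aeval (fun i => (Polynomial.X : Polynomial k) ^ a i) p).coeff d =
      ∑ u ∈ p.support with Finsupp.weight a u = d, coeff u p := by
  conv_lhs => rw [p.as_sum]
  simp only [map_sum, aeval_X_pow_monomial, Polynomial.finsetSum_coeff, Polynomial.coeff_monomial,
    Finset.sum_filter]

theorem monomialCon_monomialCurveIdeal_iff {u v : Fin m →₀ ℕ} :
    monomialCon (monomialCurveIdeal k a) u v ↔ Finsupp.weight a u = Finsupp.weight a v := by
  rw [monomialCon_iff, monomialCurveIdeal, RingHom.mem_ker, map_sub, aeval_X_pow_monomial,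
    aeval_X_pow_monomial, sub_eq_zero]
  exact Polynomial.monomial_left_inj one_ne_zero

theorem monomialCurveIdeal_le {I : Ideal (MvPolynomial (Fin m) k)}
    (h : ∀ u v, Finsupp.weight a u = Finsupp.weight a v → monomialCon I u v) :
    monomialCurveIdeal k a ≤ I := by
  -- `t^d` is sent to the class of any monomial of weight `d`, so that the quotient map by `I`
  -- factors through the parametrization of the curve.
  let ψ : Polynomial k →ₗ[k] MvPolynomial (Fin m) k ⧸ I :=
    (Polynomial.basisMonomials k).constr k fun d =>
      Ideal.Quotient.mk I (monomial (Function.invFun (Finsupp.weight a) d) 1)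
  have hψ (d : ℕ) : ψ (Polynomial.monomial d 1) =
      Ideal.Quotient.mk I (monomial (Function.invFun (Finsupp.weight a) d) 1) := by
    simpa only [Polynomial.coe_basisMonomials] using
      (Polynomial.basisMonomials k).constr_basis k _ d
  have hfactor : ψ ∘ₗ (aeval fun i => (Polynomial.X : Polynomial k) ^ a i).toLinearMap =
      (Ideal.Quotient.mkₐ k I).toLinearMap := by
    refine MvPolynomial.linearMap_ext fun u => LinearMap.ext_ring ?_
    simp only [LinearMap.comp_apply, AlgHom.toLinearMap_apply, aeval_X_pow_monomial, hψ,
      Ideal.Quotient.mkₐ_eq_mk]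
    exact h _ _ (Function.invFun_eq ⟨u, rfl⟩)
  intro p hp
  rw [monomialCurveIdeal, RingHom.mem_ker] at hp
  rw [← Ideal.Quotient.eq_zero_iff_mem, ← Ideal.Quotient.mkₐ_eq_mk k, ← AlgHom.toLinearMap_apply,
    ← hfactor, LinearMap.comp_apply, AlgHom.toLinearMap_apply, hp, map_zero]

theorem eq_monomialCurveIdeal_of_injOn {I : Ideal (MvPolynomial (Fin m) k)}
    (hI : I ≤ monomialCurveIdeal k a) {N : Set (Fin m →₀ ℕ)}
    (hN : Set.InjOn (Finsupp.weight a) N) (h : ∀ u, ∃ v ∈ N, monomialCon I u v) :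
    I = monomialCurveIdeal k a := by
  have hweight {u v} (huv : monomialCon I u v) : Finsupp.weight a u = Finsupp.weight a v :=
    monomialCon_monomialCurveIdeal_iff.1 (monomialCon_mono hI huv)
  refine le_antisymm hI (monomialCurveIdeal_le fun u v huv => ?_)
  obtain ⟨u', hu', huu'⟩ := h u
  obtain ⟨v', hv', hvv'⟩ := h v
  obtain rfl : u' = v' := hN hu' hv' (by rw [← hweight huu', huv, hweight hvv'])
  exact (monomialCon I).trans huu' ((monomialCon I).symm hvv')

end MonomialCurve

section NumberOfGenerators

/-- An augmentation-semilinear functional turns `A`-linear combinations of elements of an ideal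
into `k`-linear ones. -/
theorem span_image_eq_map_of_map_mul {k A V : Type*} [Field k] [CommRing A] [Algebra k A]
    [AddCommGroup V] [Module k V] {ε : A → k} {Λ : A →ₗ[k] V} {T : Set A}
    (hΛ : ∀ q, ∀ p ∈ Ideal.span T, Λ (q * p) = ε q • Λ p) :
    Submodule.span k (Λ '' T) = ((Ideal.span T).restrictScalars k).map Λ := by
  refine le_antisymm (Submodule.span_le.2 (Set.image_mono Ideal.subset_span)) ?_
  rintro _ ⟨p, hp, rfl⟩
  replace hp : p ∈ Ideal.span T := hp
  induction hp using Submodule.span_induction with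
  | mem x hx => exact Submodule.subset_span ⟨x, hx, rfl⟩
  | zero => rw [map_zero]; exact zero_mem _
  | add x y _ _ hx hy => rw [map_add]; exact add_mem hx hy
  | smul q x hxT hx =>
    rw [smul_eq_mul, hΛ q x hxT]
    exact Submodule.smul_mem _ _ hx

theorem card_le_encard_of_span_eq_top {k ι : Type*} [Field k] [Fintype ι] {S : Set (ι → k)}
    (hS : Submodule.span k S = ⊤) : (Fintype.card ι : ℕ∞) ≤ S.encard := by
  have hrank := rank_span_le (R := k) S
  rw [hS, rank_top, rank_fun'] at hrank
  simpa only [map_natCast, Set.toENat_cardinalMk] using OrderHomClass.mono Cardinal.toENat hrank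

variable {k : Type*} [Field k]

theorem coeff_mul_eq_constantCoeff_smul {σ : Type*} {I : Ideal (MvPolynomial σ k)} {u : σ →₀ ℕ}
    (hu : ∀ i, ∀ p ∈ I, coeff u (X i * p) = 0) (q : MvPolynomial σ k)
    {p : MvPolynomial σ k} (hp : p ∈ I) : coeff u (q * p) = constantCoeff q • coeff u p := by
  induction q using MvPolynomial.induction_on with
  | C b => rw [coeff_C_mul, constantCoeff_C, smul_eq_mul]
  | add q₁ q₂ h₁ h₂ => rw [add_mul, coeff_add, h₁, h₂, map_add, add_smul]
  | mul_X q i _ =>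
    rw [mul_comm q, mul_assoc, hu i _ (I.mul_mem_left q hp), map_mul, constantCoeff_X, zero_mul,
      zero_smul]

variable {ι : Type*}

theorem coeff_monomial_sub_monomial [DecidableEq ι] {σ : Type*} {u v : ι → σ →₀ ℕ}
    (hu : Function.Injective u) (huv : ∀ i j, u i ≠ v j) (i j : ι) :
    coeff (u i) (monomial (u j) (1 : k) - monomial (v j) 1) = if i = j then 1 else 0 := by
  classical
  rw [coeff_sub, coeff_monomial, coeff_monomial, if_neg (huv i j).symm, sub_zero]
  exact if_congr (hu.eq_iff.trans eq_comm) rfl rfl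

theorem monomial_sub_monomial_injective {σ : Type*} {u v : ι → σ →₀ ℕ}
    (hu : Function.Injective u) (huv : ∀ i j, u i ≠ v j) :
    Function.Injective fun i => monomial (u i) (1 : k) - monomial (v i) 1 := by
  classical
  intro i j hij
  have hcoeff := congrArg (coeff (u i)) hij
  simp only [coeff_monomial_sub_monomial hu huv, if_true] at hcoeff
  by_contra hne
  simp [hne] at hcoeff

/-- The coefficients at the exponent vectors `u i` vanish on `𝔪 * I`, where `𝔪` is the ideal
generated by the variables, so that they are coordinates on `I / 𝔪 * I`. -/
theorem card_le_encard_of_coeff_X_mul_eq_zero {σ : Type*} [Fintype ι]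
    {I : Ideal (MvPolynomial σ k)} {u v : ι → σ →₀ ℕ} (hu : Function.Injective u)
    (huv : ∀ i j, u i ≠ v j) (hI : ∀ i, monomialCon I (u i) (v i))
    (hX : ∀ i x, ∀ p ∈ I, coeff (u i) (X x * p) = 0)
    {T : Set (MvPolynomial σ k)} (hT : Ideal.span T = I) :
    (Fintype.card ι : ℕ∞) ≤ T.encard := by
  classical
  subst hT
  let Λ : MvPolynomial σ k →ₗ[k] ι → k := LinearMap.pi fun i => lcoeff k (u i)
  have hΛ : ∀ q, ∀ p ∈ Ideal.span T, Λ (q * p) = constantCoeff q • Λ p := fun q p hp =>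
    funext fun i => coeff_mul_eq_constantCoeff_smul (hX i) q hp
  have htop : Submodule.span k (Λ '' T) = ⊤ := by
    rw [span_image_eq_map_of_map_mul hΛ, eq_top_iff, ← (Pi.basisFun k ι).span_eq,
      Submodule.span_le]
    rintro _ ⟨j, rfl⟩
    refine ⟨_, monomialCon_iff.1 (hI j), funext fun i => ?_⟩
    rw [Pi.basisFun_apply, Pi.single_apply]
    exact coeff_monomial_sub_monomial hu huv i j
  exact (card_le_encard_of_span_eq_top htop).trans (Set.encard_image_le _ _)

/-- An exponent vector `u` is isolated for the weights `a` if its monomial has no variable in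
common with any other monomial of the same weight. -/
def IsIsolated {σ : Type*} (a : σ → ℕ) (u : σ →₀ ℕ) : Prop :=
  ∀ v, Finsupp.weight a v = Finsupp.weight a u → ∀ i, u i ≠ 0 → v i ≠ 0 → v = u

variable {m : ℕ} {a : Fin m → ℕ}

theorem coeff_eq_zero_of_mem_monomialCurveIdeal {p : MvPolynomial (Fin m) k}
    (hp : p ∈ monomialCurveIdeal k a) {u : Fin m →₀ ℕ}
    (hu : ∀ v, Finsupp.weight a v = Finsupp.weight a u → v = u) : coeff u p = 0 := by
  rw [monomialCurveIdeal, RingHom.mem_ker] at hp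
  have hsum := coeff_aeval_X_pow (a := a) p (Finsupp.weight a u)
  rw [hp, Polynomial.coeff_zero, Finset.sum_filter, Finset.sum_eq_single u] at hsum
  · simpa using hsum.symm
  · exact fun v _ hv => if_neg (mt (hu v) hv)
  · simp

theorem IsIsolated.coeff_X_mul_eq_zero {u : Fin m →₀ ℕ} (hu : IsIsolated a u) (i : Fin m)
    {p : MvPolynomial (Fin m) k} (hp : p ∈ monomialCurveIdeal k a) : coeff u (X i * p) = 0 := by
  rw [coeff_X_mul', ite_eq_right_iff, Finsupp.mem_support_iff]
  intro hi
  obtain ⟨u, rfl⟩ := exists_add_of_le (Finsupp.single_le_iff.2 (Nat.one_le_iff_ne_zero.2 hi))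
  rw [add_tsub_cancel_left]
  refine coeff_eq_zero_of_mem_monomialCurveIdeal hp fun v hv => ?_
  exact add_left_cancel (hu (Finsupp.single i 1 + v) (by rw [map_add, map_add, hv]) i hi (by simp))

theorem card_le_encard_of_isIsolated [Fintype ι] {u v : ι → Fin m →₀ ℕ}
    (hu : Function.Injective u) (huv : ∀ i j, u i ≠ v j)
    (hw : ∀ i, Finsupp.weight a (u i) = Finsupp.weight a (v i))
    (hiso : ∀ i, IsIsolated a (u i)) {T : Set (MvPolynomial (Fin m) k)}
    (hT : Ideal.span T = monomialCurveIdeal k a) : (Fintype.card ι : ℕ∞) ≤ T.encard :=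
  card_le_encard_of_coeff_X_mul_eq_zero hu huv
    (fun i => monomialCon_monomialCurveIdeal_iff.2 (hw i))
    (fun i x _ hp => (hiso i).coeff_X_mul_eq_zero x hp) hT

end NumberOfGenerators

namespace Backelin

variable {k : Type*} [Field k] {n r : ℕ}

/-- The exponent vector of the monomial `x₁ᵃ x₂ᵇ x₃ᶜ x₄ᵈ`. -/
noncomputable def expo (a b c d : ℕ) : Fin 4 →₀ ℕ := Finsupp.equivFunOnFinite.symm ![a, b, c, d]

@[simp]
theorem coe_expo (a b c d : ℕ) : ⇑(expo a b c d) = ![a, b, c, d] := rfl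

theorem eq_iff_apply {u v : Fin 4 →₀ ℕ} :
    u = v ↔ u 0 = v 0 ∧ u 1 = v 1 ∧ u 2 = v 2 ∧ u 3 = v 3 := by
  simp [DFunLike.ext_iff, Fin.forall_fin_succ]

theorem le_iff_apply {u v : Fin 4 →₀ ℕ} :
    u ≤ v ↔ u 0 ≤ v 0 ∧ u 1 ≤ v 1 ∧ u 2 ≤ v 2 ∧ u 3 ≤ v 3 := by
  simp [Finsupp.le_def, Fin.forall_fin_succ]

theorem monomial_expo (a b c d : ℕ) :
    monomial (expo a b c d) (1 : k) = x₁ k ^ a * x₂ k ^ b * x₃ k ^ c * x₄ k ^ d := by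
  simp [monomial_eq, Finsupp.prod_fintype, Fin.prod_univ_four]

/-- With `N = 3n + 2` and `s = rN + 3` the four weights are `s`, `s + 3`, `s + N - 1`, `s + N`, so
that the weight of `u` is `s |u| + N (u₃ + u₄) + 3 u₂ - u₃`. -/
theorem weight_eq_iff {u v : Fin 4 →₀ ℕ} :
    Finsupp.weight (backelinSeq n r) u = Finsupp.weight (backelinSeq n r) v ↔
      ∃ t m : ℤ, (u 0 + u 1 + u 2 + u 3 : ℤ) = v 0 + v 1 + v 2 + v 3 + t ∧
        (v 2 + v 3 : ℤ) = u 2 + u 3 + r * t + m ∧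
        (3 * n + 2) * m = (v 2 - u 2) - 3 * (v 1 - u 1) + 3 * t := by
  simp only [Finsupp.weight_eq_sum, Fin.sum_univ_four, smul_eq_mul, backelinSeq,
    Matrix.cons_val]
  zify
  constructor
  · intro h
    refine ⟨u 0 + u 1 + u 2 + u 3 - (v 0 + v 1 + v 2 + v 3), v 2 + v 3 - (u 2 + u 3) -
      r * (u 0 + u 1 + u 2 + u 3 - (v 0 + v 1 + v 2 + v 3)), by ring, by ring, ?_⟩
    linear_combination -h
  · rintro ⟨t, m, ht, hm, h⟩
    linear_combination (r * (3 * n + 2) + 3 : ℤ) * ht - (3 * n + 2 : ℤ) * hm - h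

section Binomials

/-- Indices for the binomials: `f₁`, `f₅`, `f₆`, `f₇`, followed by `f₂ᵢ`, where `i` is shifted by
one, `f₃ⱼ` and `f₄ⱼ`. -/
abbrev Index (n : ℕ) : Type := Fin 4 ⊕ Fin n ⊕ Fin n ⊕ Fin n

/-- The binomials as an indexed family. -/
noncomputable def gen (k : Type*) [Field k] (n r : ℕ) : Index n → MvPolynomial (Fin 4) k
  | .inl 0 => f₁ k
  | .inl 1 => f₅ k n r
  | .inl 2 => f₆ k n
  | .inl 3 => f₇ k n
  | .inr (.inl i) => f₂ k n (i + 1)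
  | .inr (.inr (.inl j)) => f₃ k n r j
  | .inr (.inr (.inr j)) => f₄ k n r j

/-- The exponent vectors of the first terms of the binomials. -/
noncomputable def lead (n r : ℕ) : Index n → Fin 4 →₀ ℕ
  | .inl 0 => expo 0 1 3 0
  | .inl 1 => expo (r - n + 2) n 1 0
  | .inl 2 => expo 0 (n + 1) 1 0
  | .inl 3 => expo 0 (2 * n + 1) 0 0
  | .inr (.inl i) => expo (n - (i + 1)) 0 (3 * (i + 1) - 1) 0
  | .inr (.inr (.inl j)) => expo (r - n + 3 + j) (n - 1 - j) 0 0
  | .inr (.inr (.inr j)) => expo (r - 2 * n + 3 + j) (2 * n - j) 0 0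

/-- The exponent vectors of the second terms of the binomials. -/
noncomputable def trail (n r : ℕ) : Index n → Fin 4 →₀ ℕ
  | .inl 0 => expo 1 0 0 3
  | .inl 1 => expo 0 0 0 (r + 2)
  | .inl 2 => expo n 0 0 2
  | .inl 3 => expo (2 * n - 1) 0 1 1
  | .inr (.inl i) => expo 0 (n - (i + 1) + 1) 0 (3 * (i + 1) - 2)
  | .inr (.inr (.inl j)) => expo 0 0 (2 + 3 * j) (r - 1 - 3 * j)
  | .inr (.inr (.inr j)) => expo 0 0 (3 * j + 1) (r + 1 - 3 * j)

theorem range_gen (k : Type*) [Field k] (n r : ℕ) : Set.range (gen k n r) = gens k n r := by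
  refine Set.Subset.antisymm (Set.range_subset_iff.2 fun i => ?_) fun p hp => ?_
  · rcases i with i | i | j | j
    · fin_cases i <;> simp [gen, gens]
    · exact Or.inl (Or.inl (Or.inl (Or.inr ⟨i + 1, by omega, by omega, rfl⟩)))
    · exact Or.inl (Or.inl (Or.inr ⟨j, j.2, rfl⟩))
    · exact Or.inl (Or.inr ⟨j, j.2, rfl⟩)
  · rcases hp with (((rfl | ⟨i, hi, hin, rfl⟩) | ⟨j, hj, rfl⟩) | ⟨j, hj, rfl⟩) | rfl | rfl | rfl
    · exact ⟨.inl 0, rfl⟩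
    · exact ⟨.inr (.inl ⟨i - 1, by omega⟩), by simp only [gen, Nat.sub_add_cancel hi]⟩
    · exact ⟨.inr (.inr (.inl ⟨j, hj⟩)), rfl⟩
    · exact ⟨.inr (.inr (.inr ⟨j, hj⟩)), rfl⟩
    · exact ⟨.inl 1, rfl⟩
    · exact ⟨.inl 2, rfl⟩
    · exact ⟨.inl 3, rfl⟩

theorem gen_eq_monomial_sub_monomial (i : Index n) :
    gen k n r i = monomial (lead n r i) 1 - monomial (trail n r i) 1 := by
  rcases i with i | i | j | j
  · fin_cases i <;> simp [gen, lead, trail, monomial_expo, f₁, f₅, f₆, f₇]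
  · simp [gen, lead, trail, monomial_expo, f₂]
  · simp [gen, lead, trail, monomial_expo, f₃]
  · simp [gen, lead, trail, monomial_expo, f₄]

theorem weight_lead (hn : 2 ≤ n) (hr : 3 * n + 2 ≤ r) (i : Index n) :
    Finsupp.weight (backelinSeq n r) (lead n r i) =
      Finsupp.weight (backelinSeq n r) (trail n r i) := by
  rw [weight_eq_iff]
  rcases i with i | i | j | j
  · fin_cases i
    · refine ⟨0, 0, ?_⟩
      simp [lead, trail]
    · refine ⟨1, 1, ?_⟩
      simp only [lead, trail, coe_expo, Matrix.cons_val]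
      omega
    · refine ⟨0, 1, ?_⟩
      simp only [lead, trail, coe_expo, Matrix.cons_val]
      omega
    · refine ⟨0, 2, ?_⟩
      simp only [lead, trail, coe_expo, Matrix.cons_val]
      omega
  · refine ⟨0, -1, ?_⟩
    simp only [lead, trail, coe_expo, Matrix.cons_val]
    omega
  · refine ⟨1, 1, ?_⟩
    simp only [lead, trail, coe_expo, Matrix.cons_val]
    omega
  · refine ⟨1, 2, ?_⟩
    simp only [lead, trail, coe_expo, Matrix.cons_val]
    omega

theorem lead_apply_three (i : Index n) : lead n r i 3 = 0 := by
  rcases i with i | i | j | j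
  · fin_cases i <;> rfl
  all_goals rfl

theorem trail_apply_three_pos (hr : 3 * n + 2 ≤ r) (i : Index n) : 0 < trail n r i 3 := by
  rcases i with i | i | j | j
  · fin_cases i <;> simp [trail]
  all_goals simp [trail]; try omega

theorem lead_ne_trail (hr : 3 * n + 2 ≤ r) (i j : Index n) : lead n r i ≠ trail n r j := fun h =>
  (trail_apply_three_pos hr j).ne' (h ▸ lead_apply_three i)

theorem lead_injective (hn : 2 ≤ n) (hr : 3 * n + 2 ≤ r) : Function.Injective (lead n r) := by
  rintro (i | i | i | i) (j | j | j | j) h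
  all_goals first
    | (fin_cases i <;> fin_cases j <;> simp [lead, eq_iff_apply] at h ⊢)
    | (fin_cases j <;> simp [lead, eq_iff_apply] at h ⊢ <;> omega)
    | (fin_cases i <;> simp [lead, eq_iff_apply] at h ⊢ <;> omega)
    | (simp [lead, eq_iff_apply, Fin.ext_iff] at h ⊢; omega)

end Binomials

section NormalForm

/-- The exponent vectors of the normal monomials, the normal forms for the reduction modulo the
binomials. They are closed under multiplication by `x₁`, on whose exponent there is no condition. -/
def normalSet (n r : ℕ) : Set (Fin 4 →₀ ℕ) :=
  {u | (u 1 = 0 ∧ u 2 ≤ 3 * n + 1 ∧ u 2 + u 3 ≤ r + 1 ∧ (u 2 % 3 = 2 → u 2 + u 3 ≤ r)) ∨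
    (1 ≤ u 1 ∧ u 1 ≤ n ∧ u 2 ≤ 2 ∧ u 3 + 3 * u 1 ≤ 3 * n) ∨
    (n + 1 ≤ u 1 ∧ u 1 ≤ 2 * n ∧ u 2 = 0 ∧ u 3 = 0)}

theorem injOn_weight_normalSet (hn : 2 ≤ n) (hr : 3 * n + 2 ≤ r) :
    Set.InjOn (Finsupp.weight (backelinSeq n r)) (normalSet n r) := by
  intro u hu v hv huv
  obtain ⟨t, m, ht, hL, hm⟩ := weight_eq_iff.1 huv
  wlog htnonneg : 0 ≤ t generalizing u v t m
  · exact (this hv hu huv.symm (-t) (-m) (by linarith) (by linarith) (by linarith)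
      (by linarith)).symm
  simp only [normalSet, Set.mem_ofPred_eq] at hu hv
  have hmgt : -3 < m := by
    have : (u 2 : ℤ) ≤ 3 * n + 1 ∧ (v 1 : ℤ) ≤ 2 * n := by omega
    nlinarith
  have htlt : t < 2 := by
    have : (v 2 + v 3 : ℤ) ≤ r + 1 := by omega
    nlinarith
  have hmlt : m < 3 := by
    have : (v 2 : ℤ) ≤ 3 * n + 1 ∧ (u 1 : ℤ) ≤ 2 * n := by omega
    nlinarith
  rw [eq_iff_apply]
  interval_cases t <;> interval_cases m <;> omega

end NormalForm

section Reduction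

variable (k n r) in
/-- The congruence of exponent vectors modulo the binomials. -/
noncomputable abbrev gensCon : AddCon (Fin 4 →₀ ℕ) :=
  monomialCon (Ideal.span (gens k n r))

theorem gensCon_lead_trail (i : Index n) : gensCon k n r (lead n r i) (trail n r i) := by
  rw [monomialCon_iff, ← gen_eq_monomial_sub_monomial]
  exact Ideal.subset_span (range_gen k n r ▸ Set.mem_range_self i)

theorem span_gens_le (hn : 2 ≤ n) (hr : 3 * n + 2 ≤ r) :
    Ideal.span (gens k n r) ≤ monomialCurveIdeal k (backelinSeq n r) := by
  rw [← range_gen, Ideal.span_le]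
  rintro _ ⟨i, rfl⟩
  rw [gen_eq_monomial_sub_monomial]
  exact monomialCon_iff.1 (monomialCon_monomialCurveIdeal_iff.2 (weight_lead hn hr i))

theorem isMultipleMod_of_lead_le {u : Fin 4 →₀ ℕ} (i : Index n) (hi : trail n r i 0 ≠ 0)
    (hu : lead n r i ≤ u) : IsMultipleMod (gensCon k n r) 0 u :=
  .of_le ⟨_, gensCon_lead_trail i, hi⟩ hu

theorem isMultipleMod_of_trail_le {u : Fin 4 →₀ ℕ} (i : Index n) (hi : lead n r i 0 ≠ 0)
    (hu : trail n r i ≤ u) : IsMultipleMod (gensCon k n r) 0 u :=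
  .of_le ⟨_, (gensCon k n r).symm (gensCon_lead_trail i), hi⟩ hu

/-- The second alternative is the case `j = n` missing from the family `f₄ⱼ`. -/
theorem isMultipleMod_of_le_apply_two (hn : 2 ≤ n) (hr : 3 * n + 2 ≤ r) {u : Fin 4 →₀ ℕ}
    (hu : 3 * n + 2 ≤ u 2 ∨ u 2 = 3 * n + 1 ∧ r + 2 ≤ u 2 + u 3) :
    IsMultipleMod (gensCon k n r) 0 u := by
  have hlead : lead n r (.inr (.inl ⟨n - 1, by omega⟩)) ≤ u := by
    simp only [le_iff_apply, lead, coe_expo, Matrix.cons_val]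
    omega
  refine .of_con (con_add_tsub_of_le (gensCon_lead_trail _) hlead) ?_
  rcases hu with hu | hu
  · refine isMultipleMod_of_lead_le (.inl 0) (by simp [trail]) ?_
    simp only [le_iff_apply, lead, trail, Finsupp.add_apply, Finsupp.tsub_apply, coe_expo,
      Matrix.cons_val]
    omega
  · refine isMultipleMod_of_trail_le (.inr (.inr (.inl ⟨0, by omega⟩))) (by simp [lead]) ?_
    simp only [le_iff_apply, lead, trail, Finsupp.add_apply, Finsupp.tsub_apply, coe_expo,
      Matrix.cons_val]
    omega

theorem mem_normalSet_or_isMultipleMod_of_apply_one_eq_zero (hn : 2 ≤ n) (hr : 3 * n + 2 ≤ r)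
    {u : Fin 4 →₀ ℕ} (hu : u 1 = 0) :
    u ∈ normalSet n r ∨ IsMultipleMod (gensCon k n r) 0 u := by
  by_cases htwo : 3 * n + 2 ≤ u 2 ∨ u 2 = 3 * n + 1 ∧ r + 2 ≤ u 2 + u 3
  · exact .inr (isMultipleMod_of_le_apply_two hn hr htwo)
  refine or_iff_not_imp_left.2 fun hnormal => ?_
  simp only [normalSet, Set.mem_ofPred_eq] at hnormal
  obtain hc | ⟨j, hj, hc⟩ | ⟨j, hj, hc⟩ : u 2 = 0 ∨
      (∃ j < n, (u 2 = 3 * j + 2 ∨ u 2 = 3 * j + 3) ∧ r + 1 ≤ u 3 + 3 * j + 2) ∨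
      ∃ j < n, u 2 = 3 * j + 1 ∧ r + 2 ≤ u 2 + u 3 := by
    rcases (by omega : u 2 % 3 = 0 ∨ u 2 % 3 = 1 ∨ u 2 % 3 = 2) with h | h | h
    · by_cases hzero : u 2 = 0
      · exact .inl hzero
      · exact .inr (.inl ⟨u 2 / 3 - 1, by omega⟩)
    · exact .inr (.inr ⟨u 2 / 3, by omega⟩)
    · exact .inr (.inl ⟨u 2 / 3, by omega⟩)
  · refine isMultipleMod_of_trail_le (.inl 1) (by simp [lead]) ?_
    simp only [le_iff_apply, trail, coe_expo, Matrix.cons_val]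
    omega
  · refine isMultipleMod_of_trail_le (.inr (.inr (.inl ⟨j, hj⟩))) (by simp [lead]) ?_
    simp only [le_iff_apply, trail, coe_expo, Matrix.cons_val]
    omega
  · refine isMultipleMod_of_trail_le (.inr (.inr (.inr ⟨j, hj⟩))) (by simp [lead]) ?_
    simp only [le_iff_apply, trail, coe_expo, Matrix.cons_val]
    omega

theorem mem_normalSet_or_isMultipleMod_of_apply_one_ne_zero (hn : 2 ≤ n) {u : Fin 4 →₀ ℕ}
    (hu : u 1 ≠ 0) (hu' : u 1 = 1 → u 3 < 3 * n - 2) :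
    u ∈ normalSet n r ∨ IsMultipleMod (gensCon k n r) 0 u := by
  refine or_iff_not_imp_left.2 fun hnormal => ?_
  simp only [normalSet, Set.mem_ofPred_eq] at hnormal
  obtain hx | hx | hx | hx | hx : 3 ≤ u 2 ∨ (2 ≤ u 1 ∧ u 1 ≤ n ∧ 3 * n + 1 ≤ u 3 + 3 * u 1) ∨
      (n + 1 ≤ u 1 ∧ 1 ≤ u 2) ∨ 2 * n + 1 ≤ u 1 ∨ n ≤ u 1 ∧ 1 ≤ u 3 := by omega
  · refine isMultipleMod_of_lead_le (.inl 0) (by simp [trail]) ?_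
    simp only [le_iff_apply, lead, coe_expo, Matrix.cons_val]
    omega
  · refine isMultipleMod_of_trail_le (.inr (.inl ⟨n - u 1, by omega⟩))
      (by simp [lead]; omega) ?_
    simp only [le_iff_apply, trail, coe_expo, Matrix.cons_val]
    omega
  · refine isMultipleMod_of_lead_le (.inl 2) (by simp [trail]; omega) ?_
    simp only [le_iff_apply, lead, coe_expo, Matrix.cons_val]
    omega
  · refine isMultipleMod_of_lead_le (.inl 3) (by simp [trail]; omega) ?_
    simp only [le_iff_apply, lead, coe_expo, Matrix.cons_val]
    omega
  · refine isMultipleMod_of_trail_le (.inr (.inl ⟨0, by omega⟩)) (by simp [lead]; omega) ?_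
    simp only [le_iff_apply, trail, coe_expo, Matrix.cons_val]
    omega

theorem exists_mem_normalSet_or_isMultipleMod (hn : 2 ≤ n) (hr : 3 * n + 2 ≤ r)
    (u : Fin 4 →₀ ℕ) :
    (∃ v ∈ normalSet n r, gensCon k n r u v) ∨ IsMultipleMod (gensCon k n r) 0 u := by
  obtain ⟨w, huw, hw⟩ : ∃ w, gensCon k n r u w ∧
      (w ∈ normalSet n r ∨ IsMultipleMod (gensCon k n r) 0 w) := by
    by_cases hone : u 1 = 1 ∧ 3 * n - 2 ≤ u 3
    · have htrail : trail n r (.inr (.inl ⟨n - 1, by omega⟩)) ≤ u := by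
        simp only [le_iff_apply, trail, coe_expo, Matrix.cons_val]
        omega
      refine ⟨_, con_add_tsub_of_le ((gensCon k n r).symm (gensCon_lead_trail _)) htrail,
        mem_normalSet_or_isMultipleMod_of_apply_one_eq_zero hn hr ?_⟩
      simp only [lead, trail, Finsupp.add_apply, Finsupp.tsub_apply, coe_expo, Matrix.cons_val]
      omega
    · refine ⟨u, (gensCon k n r).refl u, ?_⟩
      by_cases hu : u 1 = 0
      · exact mem_normalSet_or_isMultipleMod_of_apply_one_eq_zero hn hr hu
      · exact mem_normalSet_or_isMultipleMod_of_apply_one_ne_zero hn hu (by omega)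
  exact hw.imp (fun hw => ⟨w, hw, huw⟩) (.of_con huw)

theorem weight_eq_of_gensCon (hn : 2 ≤ n) (hr : 3 * n + 2 ≤ r) {u v : Fin 4 →₀ ℕ}
    (h : gensCon k n r u v) :
    Finsupp.weight (backelinSeq n r) u = Finsupp.weight (backelinSeq n r) v :=
  monomialCon_monomialCurveIdeal_iff.1 (monomialCon_mono (span_gens_le hn hr) h)

theorem exists_mem_normalSet_gensCon (hn : 2 ≤ n) (hr : 3 * n + 2 ≤ r) (u : Fin 4 →₀ ℕ) :
    ∃ v ∈ normalSet n r, gensCon k n r u v :=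
  exists_mem_con_of_isMultipleMod (i := 0) (w := backelinSeq n r) (Nat.succ_ne_zero _)
    (fun _ _ => weight_eq_of_gensCon hn hr)
    (fun _ hu => by simpa [normalSet] using hu)
    (exists_mem_normalSet_or_isMultipleMod hn hr) u

theorem span_gens (k : Type*) [Field k] (hn : 2 ≤ n) (hr : 3 * n + 2 ≤ r) :
    Ideal.span (gens k n r) = monomialCurveIdeal k (backelinSeq n r) :=
  eq_monomialCurveIdeal_of_injOn (span_gens_le hn hr) (injOn_weight_normalSet hn hr)
    (exists_mem_normalSet_gensCon hn hr)

end Reduction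

section Isolation

theorem exists_shift_of_weight_eq (hn : 2 ≤ n) (hr : 3 * n + 2 ≤ r)
    {u v : Fin 4 →₀ ℕ} (hu₃ : u 3 = 0) (hu₁ : u 1 ≤ 2 * n + 1) (hu₂ : u 2 + 2 ≤ r)
    (hu : u 0 + u 1 + u 2 ≤ r + 3) (hu₀ : u 2 ≤ 1 ∨ 3 * u 0 + u 2 + 2 < 6 * n)
    (h : Finsupp.weight (backelinSeq n r) u = Finsupp.weight (backelinSeq n r) v) :
    ∃ t m : ℤ, 0 ≤ t ∧ t < 2 ∧ -2 < m ∧ m < 3 ∧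
      (u 0 + u 1 + u 2 : ℤ) = v 0 + v 1 + v 2 + v 3 + t ∧ (v 2 + v 3 : ℤ) = u 2 + r * t + m ∧
        (3 * n + 2) * m = (v 2 - u 2) - 3 * (v 1 - u 1) + 3 * t := by
  obtain ⟨t, m, ht, hL, hm⟩ := weight_eq_iff.1 h
  simp only [hu₃, Nat.cast_zero, add_zero] at ht hL
  zify at hn hr hu₁ hu₂ hu hu₀
  have hcoord (w : Fin 4 →₀ ℕ) (i : Fin 4) : (0 : ℤ) ≤ w i := by positivity
  -- Both sides are the amount by which the weight of `v` exceeds `s` times its degree.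
  have hexcess : (3 * n + 1) * v 2 + (3 * n + 2) * v 3 + 3 * v 1 =
      (3 * n + 1) * u 2 + 3 * u 1 + (r * (3 * n + 2) + 3) * t := by
    linear_combination (3 * n + 2 : ℤ) * hL + hm
  have htnonneg : 0 ≤ t := by
    by_contra! hneg
    nlinarith [mul_nonneg (by positivity : (0 : ℤ) ≤ 3 * n + 1) (hcoord v 2),
      mul_nonneg (by positivity : (0 : ℤ) ≤ 3 * n + 2) (hcoord v 3),
      mul_le_mul_of_nonneg_left hu₂ (by positivity : (0 : ℤ) ≤ 3 * n + 1),
      mul_nonneg (by positivity : (0 : ℤ) ≤ r * (3 * n + 2) + 3) (by linarith : 0 ≤ -1 - t)]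
  have htlt : t < 2 := by
    have hle : (v 1 + v 2 + v 3 : ℤ) ≤ r + 3 - t := by linarith [hcoord v 0]
    by_contra! htwo
    nlinarith [mul_nonneg (by positivity : (0 : ℤ) ≤ n) (hcoord v 1),
      mul_nonneg (by positivity : (0 : ℤ) ≤ 3 * n + 1) (hcoord u 2),
      mul_le_mul_of_nonneg_left hle (by positivity : (0 : ℤ) ≤ 3 * n + 2),
      mul_le_mul_of_nonneg_left htwo (by positivity : (0 : ℤ) ≤ r * (3 * n + 2) + 3 + (3 * n + 2))]
  have hmgt : -2 < m := by
    have hm' : (3 * n - 1) * m = (v 2 - u 2) - 3 * (u 0 - v 0) + (3 * r + 6) * t := by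
      linear_combination hm + 3 * ht + 3 * hL
    by_contra! hle
    have := mul_le_mul_of_nonneg_left hle (by linarith : (0 : ℤ) ≤ 3 * n - 1)
    interval_cases t <;> omega
  have hmlt : m < 3 := by
    have hm' : (3 * n + 1) * m = 3 * u 1 - 3 * v 1 - v 3 + (r + 3) * t := by
      linear_combination hm + hL
    by_contra! hge
    have := mul_le_mul_of_nonneg_left hge (by positivity : (0 : ℤ) ≤ 3 * n + 1)
    interval_cases t <;> omega
  exact ⟨t, m, htnonneg, htlt, hmgt, hmlt, ht, hL, hm⟩

theorem isIsolated_lead (hn : 2 ≤ n) (hr : 3 * n + 2 ≤ r) (i : Index n) :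
    IsIsolated (backelinSeq n r) (lead n r i) := by
  intro v hv x hux hvx
  have hcommon : (lead n r i 0 ≠ 0 ∧ v 0 ≠ 0) ∨ (lead n r i 1 ≠ 0 ∧ v 1 ≠ 0) ∨
      (lead n r i 2 ≠ 0 ∧ v 2 ≠ 0) := by
    have := lead_apply_three (r := r) i
    fin_cases x <;> tauto
  have hbound : lead n r i 1 ≤ 2 * n + 1 ∧ lead n r i 2 + 2 ≤ r ∧
      lead n r i 0 + lead n r i 1 + lead n r i 2 ≤ r + 3 ∧
      (lead n r i 2 ≤ 1 ∨ 3 * lead n r i 0 + lead n r i 2 + 2 < 6 * n) := by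
    rcases i with i | i | j | j
    · fin_cases i <;> simp only [lead, coe_expo, Matrix.cons_val] <;> omega
    all_goals simp only [lead, coe_expo, Matrix.cons_val]; omega
  obtain ⟨t, m, ht₀, ht, hm₀, hm, h₁, h₂, h₃⟩ := exists_shift_of_weight_eq hn hr
    (lead_apply_three i) hbound.1 hbound.2.1 hbound.2.2.1 hbound.2.2.2 hv.symm
  rw [eq_iff_apply]
  rcases i with i | i | j | j
  · fin_cases i
    all_goals
      simp only [lead, coe_expo, Matrix.cons_val] at *
      interval_cases t <;> interval_cases m <;> omega
  all_goals
    simp only [lead, coe_expo, Matrix.cons_val] at *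
    interval_cases t <;> interval_cases m <;> omega

end Isolation

section NumberOfGenerators

theorem encard_gens_eq_card (k : Type*) [Field k] (hn : 2 ≤ n) (hr : 3 * n + 2 ≤ r) :
    (gens k n r).encard = Fintype.card (Index n) := by
  have hinj : Function.Injective (gen k n r) := by
    simpa only [← gen_eq_monomial_sub_monomial] using
      monomial_sub_monomial_injective (k := k) (lead_injective hn hr) (lead_ne_trail hr)
  rw [← range_gen, ← Set.image_univ, hinj.encard_image, Set.encard_univ,
    ENat.card_eq_coe_fintype_card]

theorem encard_gens (k : Type*) [Field k] (hn : 2 ≤ n) (hr : 3 * n + 2 ≤ r) :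
    (gens k n r).encard = 3 * n + 4 := by
  rw [encard_gens_eq_card k hn hr, Fintype.card_sum, Fintype.card_sum, Fintype.card_sum,
    Fintype.card_fin, Fintype.card_fin]
  norm_cast
  omega

theorem encard_gens_le_encard (k : Type*) [Field k] (hn : 2 ≤ n) (hr : 3 * n + 2 ≤ r)
    {T : Set (MvPolynomial (Fin 4) k)}
    (hT : Ideal.span T = monomialCurveIdeal k (backelinSeq n r)) :
    (gens k n r).encard ≤ T.encard := by
  rw [encard_gens_eq_card k hn hr]
  exact card_le_encard_of_isIsolated (lead_injective hn hr) (lead_ne_trail hr)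
    (weight_lead hn hr) (isIsolated_lead hn hr) hT

end NumberOfGenerators

end Backelin

theorem mainTheorem4 (k : Type*) [Field k] (n r : ℕ) (hn : 2 ≤ n) (hr : 3 * n + 2 ≤ r) :
    -- the binomials generate the defining ideal
    Ideal.span (Backelin.gens k n r) = monomialCurveIdeal k (backelinSeq n r) ∧
    -- no proper subset of them does
    (∀ T : Set (MvPolynomial (Fin 4) k), T ⊂ Backelin.gens k n r →
      Ideal.span T ≠ monomialCurveIdeal k (backelinSeq n r)) ∧
    -- the listed binomials are pairwise distinct, and no generating set has fewer elements
    (Backelin.gens k n r).encard = 3 * n + 4 ∧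
    (∀ T : Set (MvPolynomial (Fin 4) k),
      Ideal.span T = monomialCurveIdeal k (backelinSeq n r) →
      (Backelin.gens k n r).encard ≤ T.encard) := by
  refine ⟨Backelin.span_gens k hn hr, fun T hT hspan => ?_, Backelin.encard_gens k hn hr,
    fun T => Backelin.encard_gens_le_encard k hn hr⟩
  have hfinite : (Backelin.gens k n r).Finite := Backelin.range_gen k n r ▸ Set.finite_range _
  exact ((hfinite.subset hT.subset).encard_lt_encard hT).not_ge
    (Backelin.encard_gens_le_encard k hn hr hspan)
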